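/- Let $F$ be a field of characteristic different from $2$, and let $W(F)$ be its Witt ring, i.e. the ring of Witt classes of nonsingular finite-dimensional quadratic forms over $F$, with addition induced by orthogonal sum and multiplication by tensor product. Let $I(F)\subset W(F)$ be the fundamental ideal of classes of even-dimensional forms, and let $$A(F)=\{f(X)\in\mathbb Z[X] : f(\varphi)=0\ \text{ for all }\ \varphi\in W(F)\}$$ be the full annihilator ideal. Suppose that $F$ is nonreal (that is, $-1$ is a sum of squares in $F$), and that its level $s(F)$, the least $n$ such that $-1$ is a sum of $n$ squares in $F$, equals $2^{r-1}$ with $r\ge 1$. Let $\nu_2$ denote the $2$-adic valuation and let $k\ge 1$ be the integer uniquely determined by $$\nu_2((2k-2)!)<r\le \nu_2((2k)!).$$ If $s(F)\cdot I(F)^{2k-1}\neq 0$ in $W(F)$, then $$A(F)=J_r=J_{e,r}\cdot J_{o,r},$$ where $J_r$, $J_{e,r}$ and $J_{o,r}$ are the following ideals of $\mathbb Z[X]$: - $J_r$ is generated by $2^{r-\nu_2((2i)!)}X^{2i}(X-1)^{2i}$ for $0\le i\le k-1$ together with $X^{2k}(X-1)^{2k}$; - $J_{e,r}$ is generated by $2^{r-\nu_2((2i)!)}X^{2i}$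 for $0\le i\le k-1$ together with $X^{2k}$; - $J_{o,r}$ is generated by $2^{r-\nu_2((2i)!)}(X-1)^{2i}$ for $0\le i\le k-1$ together with $(X-1)^{2k}$. -/

import Mathlib

open scoped TensorProduct

universe u

namespace QuadWitt

noncomputable section

/-! ### Nonsingular quadratic spaces and their isometry classes -/

/-- A nonsingular quadratic form over `F` on a finite-dimensional vector space. -/
structure QuadSpace (F : Type u) [Field F] where
  V : Type u
  [addCommGroup : AddCommGroup V]
  [module : Module F V]
  [finite : FiniteDimensional F V]
  form : QuadraticForm F V
  nondegenerate : form.Nondegenerate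

attribute [instance] QuadSpace.addCommGroup QuadSpace.module QuadSpace.finite

section Nondegeneracy

variable {F : Type u} [Field F] [Invertible (2 : F)]
variable {V W : Type u} [AddCommGroup V] [Module F V] [AddCommGroup W] [Module F W]

theorem nondegenerate_iff {Q : QuadraticForm F V} :
    Q.Nondegenerate ↔ Function.Injective (QuadraticMap.associated Q) := by
  rw [QuadraticMap.nondegenerate_iff_radical_eq_bot, QuadraticMap.radical_eq_ker_associated,
    LinearMap.ker_eq_bot]

theorem nondegenerate_prod {Q : QuadraticForm F V} {Q' : QuadraticForm F W}
    (h : Q.Nondegenerate) (h' : Q'.Nondegenerate) :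
    QuadraticMap.Nondegenerate (Q := Q.prod Q') := by
  rw [nondegenerate_iff, injective_iff_map_eq_zero] at *
  rintro ⟨x, y⟩ hxy
  have hx : x = 0 := h x <| by
    ext v
    simpa using congr($hxy (v, 0))
  have hy : y = 0 := h' y <| by
    ext v
    simpa using congr($hxy (0, v))
  rw [hx, hy, Prod.mk_zero_zero]

theorem nondegenerate_neg {Q : QuadraticForm F V} (h : Q.Nondegenerate) :
    QuadraticMap.Nondegenerate (Q := -Q) := by
  rw [nondegenerate_iff, injective_iff_map_eq_zero] at *
  intro x hx
  refine h x ?_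
  simpa using hx

theorem nondegenerate_tmul [FiniteDimensional F V] [FiniteDimensional F W]
    {Q : QuadraticForm F V} {Q' : QuadraticForm F W}
    (h : Q.Nondegenerate) (h' : Q'.Nondegenerate) :
    QuadraticMap.Nondegenerate (Q := QuadraticForm.tmul Q Q') := by
  rw [nondegenerate_iff] at *
  let e := LinearEquiv.ofInjectiveOfFinrankEq (QuadraticMap.associated Q) h
    (Subspace.dual_finrank_eq (K := F) (V := V)).symm
  let e' := LinearEquiv.ofInjectiveOfFinrankEq (QuadraticMap.associated Q') h'
    (Subspace.dual_finrank_eq (K := F) (V := W)).symm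
  let f := (TensorProduct.congr e e').trans (TensorProduct.dualDistribEquiv F V W)
  have hf : (QuadraticMap.associated (QuadraticForm.tmul Q Q') :
      V ⊗[F] W →ₗ[F] V ⊗[F] W →ₗ[F] F) = f.toLinearMap := by
    rw [QuadraticForm.associated_tmul]
    ext v w v' w'
    simp [f, e, e', TensorProduct.dualDistribEquiv, mul_comm]
    rfl
  rw [hf]
  exact f.injective

theorem nondegenerate_sq :
    QuadraticMap.Nondegenerate (Q := (QuadraticMap.sq : QuadraticForm F F)) := by
  rw [nondegenerate_iff, injective_iff_map_eq_zero]
  intro x hx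
  simpa using congr($hx 1)

theorem nondegenerate_dualProd [FiniteDimensional F V] :
    QuadraticMap.Nondegenerate (Q := QuadraticForm.dualProd F V) := by
  rw [nondegenerate_iff, injective_iff_map_eq_zero]
  rintro ⟨f, v⟩ h
  have hf : f = 0 := by
    ext w
    have := congr($h (0, w))
    simpa [QuadraticMap.associated_apply, QuadraticMap.polar, Invertible.ne_zero (2 : F)] using this
  have hv : v = 0 := by
    rw [← Module.forall_dual_apply_eq_zero_iff F]
    intro g
    have := congr($h (g, 0))
    simpa [QuadraticMap.associated_apply, QuadraticMap.polar, Invertible.ne_zero (2 : F)] using this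
  rw [hf, hv, Prod.mk_zero_zero]

theorem nondegenerate_punit :
    QuadraticMap.Nondegenerate (Q := (0 : QuadraticForm F PUnit.{u + 1})) := by
  rw [nondegenerate_iff]
  exact Function.injective_of_subsingleton _

end Nondegeneracy

/-! ### Isometries -/

section Isometries

variable {F : Type u} [Field F]
variable {V₁ V₂ V₃ V₄ : Type u} [AddCommGroup V₁] [Module F V₁] [AddCommGroup V₂] [Module F V₂]
  [AddCommGroup V₃] [Module F V₃] [AddCommGroup V₄] [Module F V₄]

def prodAssoc (Q₁ : QuadraticForm F V₁) (Q₂ : QuadraticForm F V₂) (Q₃ : QuadraticForm F V₃) :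
    ((Q₁.prod Q₂).prod Q₃).IsometryEquiv (Q₁.prod (Q₂.prod Q₃)) where
  toLinearEquiv := LinearEquiv.prodAssoc F V₁ V₂ V₃
  map_app' x := by simp [add_assoc]

def zeroProd (Q : QuadraticForm F V₁) :
    ((0 : QuadraticForm F PUnit.{u + 1}).prod Q).IsometryEquiv Q where
  toLinearEquiv := LinearEquiv.uniqueProd
  map_app' x := by simp

def dualProdPUnit :
    (QuadraticForm.dualProd F PUnit.{u + 1}).IsometryEquiv
      (0 : QuadraticForm F PUnit.{u + 1}) where
  toLinearEquiv := LinearEquiv.ofSubsingleton _ _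
  map_app' x := by
    have : x.2 = 0 := rfl
    rw [QuadraticForm.dualProd_apply, this]
    exact (map_zero x.1).symm

variable [Invertible (2 : F)]

def tmulCongr {Q₁ : QuadraticForm F V₁} {Q₂ : QuadraticForm F V₂} {Q₃ : QuadraticForm F V₃}
    {Q₄ : QuadraticForm F V₄} (e : Q₁.IsometryEquiv Q₂) (f : Q₃.IsometryEquiv Q₄) :
    (QuadraticForm.tmul Q₁ Q₃).IsometryEquiv (QuadraticForm.tmul Q₂ Q₄) where
  toLinearEquiv := TensorProduct.congr e.toLinearEquiv f.toLinearEquiv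
  map_app' x := QuadraticForm.tmul_tensorMap_apply e.toIsometry f.toIsometry x

def tmulProd (Q₁ : QuadraticForm F V₁) (Q₂ : QuadraticForm F V₂) (Q₃ : QuadraticForm F V₃) :
    (QuadraticForm.tmul Q₁ (Q₂.prod Q₃)).IsometryEquiv
      ((QuadraticForm.tmul Q₁ Q₂).prod (QuadraticForm.tmul Q₁ Q₃)) where
  toLinearEquiv := TensorProduct.prodRight F F V₁ V₂ V₃
  map_app' x := by
    have : (((QuadraticForm.tmul Q₁ Q₂).prod (QuadraticForm.tmul Q₁ Q₃)).comp
        (TensorProduct.prodRight F F V₁ V₂ V₃).toLinearMap) =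
        QuadraticForm.tmul Q₁ (Q₂.prod Q₃) := by
      refine (QuadraticMap.associated_rightInverse F).injective ?_
      ext <;> simp [QuadraticForm.associated_tmul, QuadraticMap.associated_comp]
    exact congr($this x)

def zeroTmul (Q : QuadraticForm F V₁) :
    (QuadraticForm.tmul (0 : QuadraticForm F PUnit.{u + 1}) Q).IsometryEquiv
      (0 : QuadraticForm F PUnit.{u + 1}) where
  toLinearEquiv := LinearEquiv.ofSubsingleton _ _
  map_app' x := by
    rw [Subsingleton.elim x 0, QuadraticMap.map_zero]
    rfl

def tmulNegSq (Q : QuadraticForm F V₁) :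
    (QuadraticForm.tmul Q (-(QuadraticMap.sq : QuadraticForm F F))).IsometryEquiv (-Q) where
  toLinearEquiv := TensorProduct.rid F V₁
  map_app' x := by
    have : QuadraticForm.tmul Q (-(QuadraticMap.sq : QuadraticForm F F)) =
        -(QuadraticForm.tmul Q (QuadraticMap.sq : QuadraticForm F F)) := by
      rw [QuadraticForm.tmul, TensorProduct.tmul_neg]
      exact map_neg (QuadraticForm.tensorDistrib F F) _
    rw [this]
    exact congrArg Neg.neg (QuadraticForm.tmul_tensorRId_apply Q x)

def prodNeg [FiniteDimensional F V₁] (Q : QuadraticForm F V₁) (hQ : Q.Nondegenerate) :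
    (Q.prod (-Q)).IsometryEquiv (QuadraticForm.dualProd F V₁) where
  toLinearEquiv := LinearEquiv.ofInjectiveOfFinrankEq (QuadraticForm.toDualProd Q).toLinearMap
    (by
      rw [nondegenerate_iff, injective_iff_map_eq_zero] at hQ
      rw [injective_iff_map_eq_zero]
      rintro ⟨x, y⟩ hxy
      have h₂ : x = y := sub_eq_zero.mp congr(($hxy).2)
      have h₁ : QuadraticMap.associated Q x + QuadraticMap.associated Q y = 0 := congr(($hxy).1)
      subst h₂
      have hx : x = 0 := hQ x <| by
        rw [← two_smul F] at h₁
        exact (smul_eq_zero.mp h₁).resolve_left (Invertible.ne_zero (2 : F))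
      rw [hx, Prod.mk_zero_zero])
    (by rw [Module.finrank_prod, Module.finrank_prod, Subspace.dual_finrank_eq])
  map_app' x := (QuadraticForm.toDualProd Q).map_app x

end Isometries

/-! ### The semiring of isometry classes -/

section IsoClass

variable (F : Type u) [Field F]

instance isometrySetoid : Setoid (QuadSpace F) where
  r X Y := X.form.Equivalent Y.form
  iseqv := ⟨fun _ => .refl _, fun h => h.symm, fun h h' => h.trans h'⟩

/-- Isometry classes of nonsingular quadratic forms over `F`. -/
def IsoClass : Type (u + 1) := Quotient (isometrySetoid F)

variable {F}

/-- The isometry class of a nonsingular quadratic form. -/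
def IsoClass.mk (X : QuadSpace F) : IsoClass F := Quotient.mk _ X

theorem IsoClass.sound {X Y : QuadSpace F} (e : X.form.IsometryEquiv Y.form) :
    IsoClass.mk X = IsoClass.mk Y := Quotient.sound ⟨e⟩

variable [Invertible (2 : F)]

/-- The orthogonal sum. -/
def QuadSpace.add (X Y : QuadSpace F) : QuadSpace F :=
  ⟨X.V × Y.V, X.form.prod Y.form, nondegenerate_prod X.nondegenerate Y.nondegenerate⟩

/-- The tensor product. -/
def QuadSpace.mul (X Y : QuadSpace F) : QuadSpace F :=
  ⟨X.V ⊗[F] Y.V, QuadraticForm.tmul X.form Y.form,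
    nondegenerate_tmul X.nondegenerate Y.nondegenerate⟩

/-- The form `-q`. -/
def QuadSpace.neg (X : QuadSpace F) : QuadSpace F :=
  ⟨X.V, -X.form, nondegenerate_neg X.nondegenerate⟩

variable (F) in
/-- The zero-dimensional form. -/
def QuadSpace.zero : QuadSpace F := ⟨PUnit, 0, nondegenerate_punit⟩

variable (F) in
/-- The form `⟨1⟩`. -/
def QuadSpace.one : QuadSpace F := ⟨F, QuadraticMap.sq, nondegenerate_sq⟩

variable (F) in
/-- The hyperbolic space `V* × V` with `(f, v) ↦ f v`. -/
def QuadSpace.hyperbolic (V : Type u) [AddCommGroup V] [Module F V] [FiniteDimensional F V] :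
    QuadSpace F :=
  ⟨Module.Dual F V × V, QuadraticForm.dualProd F V, nondegenerate_dualProd⟩

instance : Zero (IsoClass F) := ⟨.mk (.zero F)⟩

instance : One (IsoClass F) := ⟨.mk (.one F)⟩

instance : Add (IsoClass F) :=
  ⟨Quotient.map₂ QuadSpace.add fun _ _ ⟨e⟩ _ _ ⟨f⟩ => ⟨QuadraticMap.IsometryEquiv.prod e f⟩⟩

instance : Mul (IsoClass F) :=
  ⟨Quotient.map₂ QuadSpace.mul fun _ _ ⟨e⟩ _ _ ⟨f⟩ => ⟨tmulCongr e f⟩⟩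

theorem IsoClass.mk_add (X Y : QuadSpace F) : mk (X.add Y) = mk X + mk Y := rfl

theorem IsoClass.mk_mul (X Y : QuadSpace F) : mk (X.mul Y) = mk X * mk Y := rfl

namespace IsoClass

protected theorem add_comm' (x y : IsoClass F) : x + y = y + x := by
  induction x, y using Quotient.inductionOn₂ with
  | h X Y => exact sound (X := X.add Y) (Y := Y.add X) (.prodComm _ _)

protected theorem add_assoc' (x y z : IsoClass F) : x + y + z = x + (y + z) := by
  induction x, y, z using Quotient.inductionOn₃ with
  | h X Y Z => exact sound (X := (X.add Y).add Z) (Y := X.add (Y.add Z)) (prodAssoc _ _ _)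

protected theorem zero_add' (x : IsoClass F) : 0 + x = x := by
  induction x using Quotient.inductionOn with
  | h X => exact sound (X := (QuadSpace.zero F).add X) (zeroProd X.form)

protected theorem mul_comm' (x y : IsoClass F) : x * y = y * x := by
  induction x, y using Quotient.inductionOn₂ with
  | h X Y => exact sound (X := X.mul Y) (Y := Y.mul X) (QuadraticForm.tensorComm _ _)

protected theorem mul_assoc' (x y z : IsoClass F) : x * y * z = x * (y * z) := by
  induction x, y, z using Quotient.inductionOn₃ with
  | h X Y Z =>
    exact sound (X := (X.mul Y).mul Z) (Y := X.mul (Y.mul Z)) (QuadraticForm.tensorAssoc _ _ _)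

protected theorem one_mul' (x : IsoClass F) : 1 * x = x := by
  induction x using Quotient.inductionOn with
  | h X => exact sound (X := (QuadSpace.one F).mul X) (QuadraticForm.tensorLId X.form)

protected theorem zero_mul' (x : IsoClass F) : 0 * x = 0 := by
  induction x using Quotient.inductionOn with
  | h X => exact sound (X := (QuadSpace.zero F).mul X) (Y := QuadSpace.zero F) (zeroTmul X.form)

protected theorem mul_add' (x y z : IsoClass F) : x * (y + z) = x * y + x * z := by
  induction x, y, z using Quotient.inductionOn₃ with
  | h X Y Z =>
    exact sound (X := X.mul (Y.add Z)) (Y := (X.mul Y).add (X.mul Z)) (tmulProd _ _ _)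

end IsoClass

/-- Isometry classes form a commutative semiring under orthogonal sum and tensor product. -/
instance : CommSemiring (IsoClass F) where
  add_assoc := IsoClass.add_assoc'
  add_comm := IsoClass.add_comm'
  zero_add := IsoClass.zero_add'
  add_zero x := (IsoClass.add_comm' x 0).trans (IsoClass.zero_add' x)
  nsmul := nsmulRec
  mul_assoc := IsoClass.mul_assoc'
  mul_comm := IsoClass.mul_comm'
  one_mul := IsoClass.one_mul'
  mul_one x := (IsoClass.mul_comm' x 1).trans (IsoClass.one_mul' x)
  zero_mul := IsoClass.zero_mul'
  mul_zero x := (IsoClass.mul_comm' x 0).trans (IsoClass.zero_mul' x)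
  left_distrib := IsoClass.mul_add'
  right_distrib x y z := by
    rw [IsoClass.mul_comm', IsoClass.mul_add', IsoClass.mul_comm' z, IsoClass.mul_comm' z]

variable (F) in
/-- The isometry class of the hyperbolic plane. -/
def hyperbolicPlane : IsoClass F := .mk (.hyperbolic F F)

theorem mk_add_mk_neg (X : QuadSpace F) :
    IsoClass.mk X + IsoClass.mk X.neg = IsoClass.mk (.hyperbolic F X.V) :=
  IsoClass.sound (X := X.add X.neg) (Y := .hyperbolic F X.V) (prodNeg X.form X.nondegenerate)

theorem mk_neg (X : QuadSpace F) :
    IsoClass.mk X.neg = IsoClass.mk X * IsoClass.mk (QuadSpace.one F).neg :=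
  (IsoClass.sound (X := X.mul (QuadSpace.one F).neg) (Y := X.neg) (tmulNegSq X.form)).symm

theorem mk_hyperbolic_congr {V W : Type u} [AddCommGroup V] [Module F V] [FiniteDimensional F V]
    [AddCommGroup W] [Module F W] [FiniteDimensional F W] (e : V ≃ₗ[F] W) :
    IsoClass.mk (.hyperbolic F V) = IsoClass.mk (.hyperbolic F W) :=
  IsoClass.sound (QuadraticForm.dualProdIsometry e)

theorem mk_hyperbolic_fin (n : ℕ) :
    IsoClass.mk (.hyperbolic F (Fin n → F)) = n • hyperbolicPlane F := by
  induction n with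
  | zero =>
    rw [zero_smul, mk_hyperbolic_congr (LinearEquiv.ofSubsingleton (Fin 0 → F) PUnit.{u + 1})]
    exact IsoClass.sound (Y := QuadSpace.zero F) dualProdPUnit
  | succ n ih =>
    rw [succ_nsmul', ← ih, mk_hyperbolic_congr (Fin.consLinearEquiv F fun _ => F).symm]
    exact IsoClass.sound (X := .hyperbolic F (F × (Fin n → F)))
      (Y := (QuadSpace.hyperbolic F F).add (.hyperbolic F (Fin n → F)))
      QuadraticForm.dualProdProdIsometry

theorem mk_hyperbolic (V : Type u) [AddCommGroup V] [Module F V] [FiniteDimensional F V] :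
    IsoClass.mk (.hyperbolic F V) = Module.finrank F V • hyperbolicPlane F := by
  rw [← mk_hyperbolic_fin, mk_hyperbolic_congr (Module.finBasis F V).equivFun]

theorem one_add_neg_one :
    (1 : IsoClass F) + IsoClass.mk (QuadSpace.one F).neg = hyperbolicPlane F :=
  mk_add_mk_neg (.one F)

theorem exists_mul_hyperbolicPlane (x : IsoClass F) :
    ∃ n : ℕ, x * hyperbolicPlane F = n • hyperbolicPlane F := by
  induction x using Quotient.inductionOn with
  | h X =>
    refine ⟨Module.finrank F X.V, ?_⟩
    change IsoClass.mk X * _ = _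
    rw [← mk_hyperbolic X.V, ← mk_add_mk_neg, mk_neg, ← one_add_neg_one, mul_add, mul_one]

end IsoClass

/-! ### The Witt ring -/

section WittRing

variable (F : Type u) [Field F] [Invertible (2 : F)]

/-- Witt equivalence: `q ~ q'` if `q ⊥ mℍ ≅ q' ⊥ nℍ` for some `m, n`. -/
def wittCon : RingCon (IsoClass F) where
  r x y := ∃ m n : ℕ, x + m • hyperbolicPlane F = y + n • hyperbolicPlane F
  iseqv :=
    { refl := fun x => ⟨0, 0, rfl⟩
      symm := fun ⟨m, n, h⟩ => ⟨n, m, h.symm⟩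
      trans := by
        rintro x y z ⟨m, n, h⟩ ⟨m', n', h'⟩
        refine ⟨m + m', n + n', ?_⟩
        rw [add_smul, ← add_assoc, h, add_right_comm, h', add_right_comm, add_smul, add_assoc] }
  add' := by
    rintro w x y z ⟨m, n, h⟩ ⟨m', n', h'⟩
    refine ⟨m + m', n + n', ?_⟩
    rw [add_smul, add_smul, add_add_add_comm, h, h', add_add_add_comm]
  mul' := by
    rintro w x y z ⟨m, n, h⟩ ⟨m', n', h'⟩
    have key : ∀ x y : IsoClass F, ∀ m n : ℕ, ∃ l : ℕ,
        (x + m • hyperbolicPlane F) * (y + n • hyperbolicPlane F) =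
          x * y + l • hyperbolicPlane F := by
      intro x y m n
      obtain ⟨a, ha⟩ := exists_mul_hyperbolicPlane x
      obtain ⟨b, hb⟩ := exists_mul_hyperbolicPlane y
      obtain ⟨c, hc⟩ := exists_mul_hyperbolicPlane (hyperbolicPlane F)
      refine ⟨n * a + m * b + m * n * c, ?_⟩
      simp only [nsmul_eq_mul] at *
      push_cast
      calc _ = x * y + (n * (x * hyperbolicPlane F) + m * (y * hyperbolicPlane F) +
            m * n * (hyperbolicPlane F * hyperbolicPlane F)) := by ring
        _ = _ := by rw [ha, hb, hc]; ring
    obtain ⟨l, hl⟩ := key w y m m'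
    obtain ⟨l', hl'⟩ := key x z n n'
    exact ⟨l, l', by rw [← hl, ← hl', h, h']⟩

/-- The Witt ring `W(F)`: Witt classes of nonsingular quadratic forms over `F`, with addition the
orthogonal sum and multiplication the tensor product. -/
def WittRing : Type (u + 1) := (wittCon F).Quotient

instance : CommSemiring (WittRing F) := inferInstanceAs (CommSemiring (wittCon F).Quotient)

variable {F}

/-- The Witt class of a nonsingular quadratic form. -/
def WittRing.mk (X : QuadSpace F) : WittRing F := (wittCon F).mk' (IsoClass.mk X)

theorem WittRing.mk_add (X Y : QuadSpace F) : mk (X.add Y) = mk X + mk Y := rfl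

theorem WittRing.mk_mul (X Y : QuadSpace F) : mk (X.mul Y) = mk X * mk Y := rfl

theorem WittRing.mk_zero : mk (.zero F) = 0 := rfl

theorem WittRing.mk_one : mk (.one F) = 1 := rfl

theorem WittRing.exists_mk (x : WittRing F) : ∃ X : QuadSpace F, x = mk X := by
  obtain ⟨y, rfl⟩ := (wittCon F).mk'_surjective x
  obtain ⟨X, rfl⟩ := Quotient.exists_rep y
  exact ⟨X, rfl⟩

theorem WittRing.mk_eq_mk {X Y : QuadSpace F} :
    mk X = mk Y ↔ ∃ m n : ℕ,
      IsoClass.mk X + m • hyperbolicPlane F = IsoClass.mk Y + n • hyperbolicPlane F :=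
  (wittCon F).eq

theorem WittRing.mk_add_mk_neg (X : QuadSpace F) : mk X + mk X.neg = 0 := by
  rw [← mk_add, ← mk_zero, mk_eq_mk]
  refine ⟨0, Module.finrank F X.V, ?_⟩
  rw [zero_smul, add_zero, ← mk_hyperbolic, ← QuadWitt.mk_add_mk_neg, IsoClass.mk_add]
  exact (zero_add _).symm

theorem WittRing.mk_neg (X : QuadSpace F) : mk X.neg = mk (QuadSpace.one F).neg * mk X := by
  rw [mul_comm]
  exact congrArg (wittCon F).mk' (QuadWitt.mk_neg X)

instance : Neg (WittRing F) := ⟨fun x => WittRing.mk (QuadSpace.one F).neg * x⟩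

instance : CommRing (WittRing F) where
  __ := (inferInstance : CommSemiring (WittRing F))
  zsmul := zsmulRec
  neg_add_cancel x := by
    obtain ⟨X, rfl⟩ := x.exists_mk
    change WittRing.mk (QuadSpace.one F).neg * WittRing.mk X + WittRing.mk X = 0
    rw [← WittRing.mk_neg, add_comm, WittRing.mk_add_mk_neg]
  mul_comm := mul_comm

variable (F)

/-- The fundamental ideal `I(F)`: the Witt classes of even-dimensional forms. -/
def fundamentalIdeal : Ideal (WittRing F) where
  carrier := {x | ∃ X : QuadSpace F, Even (Module.finrank F X.V) ∧ x = WittRing.mk X}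
  zero_mem' := ⟨.zero F, by
    change Even (Module.finrank F PUnit.{u + 1})
    rw [Module.finrank_zero_of_subsingleton]
    exact Even.zero, rfl⟩
  add_mem' := by
    rintro _ _ ⟨X, hX, rfl⟩ ⟨Y, hY, rfl⟩
    exact ⟨X.add Y, (Module.finrank_prod (R := F) (M := X.V) (M' := Y.V)) ▸ hX.add hY, rfl⟩
  smul_mem' := by
    rintro c _ ⟨X, hX, rfl⟩
    obtain ⟨C, rfl⟩ := c.exists_mk
    exact ⟨C.mul X, (Module.finrank_tensorProduct (R := F) (S := F) (M := C.V) (M' := X.V)) ▸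
      hX.mul_left _, rfl⟩

/-- The full annihilator ideal `A(F)`: the integer polynomials vanishing at every element of
`W(F)`. -/
def annihilatorIdeal : Ideal (Polynomial ℤ) where
  carrier := {f | ∀ φ : WittRing F, Polynomial.aeval φ f = 0}
  zero_mem' φ := map_zero _
  add_mem' hf hg φ := by rw [map_add, hf φ, hg φ, add_zero]
  smul_mem' c f hf φ := by rw [smul_eq_mul, map_mul, hf φ, mul_zero]

end WittRing

/-- The level of a nonreal field: the least `n` such that `-1` is a sum of `n` squares.
(For formally real fields, whose level is infinite, this has the value `0`.) -/
def level (F : Type u) [Field F] : ℕ :=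
  sInf {n : ℕ | ∃ a : Fin n → F, ∑ i, a i ^ 2 = -1}

/-! ### The ideals of `ℤ[X]` -/

open Polynomial in
/-- The ideal generated by `2^(r - ν₂((2i)!)) p^(2i)` for `0 ≤ i ≤ k - 1`, and `p^(2k)`. -/
def idealJ (p : ℤ[X]) (r k : ℕ) : Ideal ℤ[X] :=
  Ideal.span ({f | ∃ i < k, f = 2 ^ (r - padicValNat 2 (2 * i).factorial) * p ^ (2 * i)} ∪
    {p ^ (2 * k)})

open Polynomial in
/-- `J_{e,r}`, generated by `2^(r - ν₂((2i)!)) X^(2i)` for `0 ≤ i ≤ k - 1`, and `X^(2k)`. -/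
def idealJEven (r k : ℕ) : Ideal ℤ[X] := idealJ X r k

open Polynomial in
/-- `J_{o,r}`, generated by `2^(r - ν₂((2i)!)) (X - 1)^(2i)` for `0 ≤ i ≤ k - 1`, and
`(X - 1)^(2k)`. -/
def idealJOdd (r k : ℕ) : Ideal ℤ[X] := idealJ (X - 1) r k

open Polynomial in
/-- `J_r`, generated by `2^(r - ν₂((2i)!)) X^(2i) (X - 1)^(2i)` for `0 ≤ i ≤ k - 1`, and
`X^(2k) (X - 1)^(2k)`. -/
def idealJFull (r k : ℕ) : Ideal ℤ[X] := idealJ (X * (X - 1)) r k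

end

end QuadWitt

/-!
Every even-dimensional form is Witt equivalent to a sum of the classes `⟨a⟩ - 1` and of a multiple
of `2`. An element `x` of one of these two kinds satisfies `x ^ 2 = 2 * c * x`, and the binomial
theorem shows that the set of `x` for which `2 ^ ν₂(n!)` divides `x ^ n` for all `n` is closed under
addition. Hence `2 ^ ν₂(n!)` divides `φ ^ n` for all `φ ∈ I(F)`. Since `2 ^ r = 0` in `W(F)` by
Pfister's theorem on sums of `2 ^ n` squares, `J_{e,r}` annihilates `I(F)` and `J_{o,r}` annihilates
`1 + I(F)`.

Conversely, let `f` vanish on `I(F)` and have degree `d < 2k`. Taking differences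
`f(X + e) - f(X)` with `e ∈ I(F)` repeatedly shows that `d!` times the leading coefficient of `f`
annihilates `I(F) ^ d`, which contains an element of additive order `2 ^ r`. So the leading
coefficient is divisible by `2 ^ (r - ν₂(d!))`, the leading monomial of `f` lies in `J_{e,r}`, and
it can be removed. Translating by `1` gives the polynomials vanishing on `1 + I(F)`, and `J_{e,r}`
and `J_{o,r}` are coprime because `X` and `X - 1` are.
-/

namespace QuadWitt

open Polynomial

section LeadingCoefficients

theorem coeff_taylor_of_natDegree_le {R : Type*} [CommSemiring R] {f : R[X]} {d : ℕ}
    (hf : f.natDegree ≤ d + 1) (e : R) :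
    (taylor e f).coeff d = f.coeff d + (d + 1) * f.coeff (d + 1) * e := by
  have hd : (hasseDeriv d f).natDegree < 2 := by
    have := natDegree_hasseDeriv_le f d
    omega
  rw [taylor_coeff, eval_eq_sum_range' hd, Finset.sum_range_succ, Finset.sum_range_one]
  simp [hasseDeriv_coeff, add_comm 1 d]

variable {R : Type*} [CommRing R]

theorem natDegree_taylor_sub_le {f : R[X]} {d : ℕ} (hf : f.natDegree ≤ d + 1) (e : R) :
    (taylor e f - f).natDegree ≤ d := by
  rw [natDegree_le_iff_coeff_eq_zero]
  intro n hn
  rw [coeff_sub, coeff_taylor_of_natDegree_le (hf.trans (by omega)),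
    coeff_eq_zero_of_natDegree_lt (n := n + 1) (by omega)]
  ring

theorem factorial_mul_coeff_mul_eq_zero {I : Ideal R} {d : ℕ} {f : R[X]} (hd : f.natDegree ≤ d)
    (hf : ∀ x ∈ I, f.eval x = 0) {y : R} (hy : y ∈ I ^ d) :
    (d.factorial : R) * f.coeff d * y = 0 := by
  induction d generalizing f y with
  | zero => rw [coeff_zero_eq_eval_zero, hf 0 I.zero_mem, mul_zero, zero_mul]
  | succ d ih =>
    rw [pow_succ'] at hy
    induction hy using Submodule.mul_induction_on' with
    | mem_mul_mem e he y hy =>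
      have hdiff : ∀ x ∈ I, (taylor e f - f).eval x = 0 := fun x hx => by
        rw [eval_sub, taylor_eval, hf x hx, hf _ (I.add_mem hx he), sub_zero]
      have hzero := ih (natDegree_taylor_sub_le hd e) hdiff hy
      rw [coeff_sub, coeff_taylor_of_natDegree_le hd] at hzero
      rw [Nat.factorial_succ, ← hzero]
      push_cast
      ring
    | add y _ z _ hy hz => rw [mul_add, hy, hz, add_zero]

theorem le_of_monomial_leadingCoeff_mem {A S : Type*} [Ring A] [Ring S] [Module S A[X]]
    {M N : Submodule S A[X]} (hNM : N ≤ M)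
    (h : ∀ f ∈ M, monomial f.natDegree f.leadingCoeff ∈ N) : M ≤ N := by
  intro f hf
  induction hcard : f.support.card using Nat.strong_induction_on generalizing f with
  | _ c ih =>
    obtain rfl | hf₀ := eq_or_ne f 0
    · exact N.zero_mem
    have herase : f.eraseLead ∈ M := by
      rw [← self_sub_monomial_natDegree_leadingCoeff]
      exact M.sub_mem hf (hNM (h f hf))
    rw [← eraseLead_add_monomial_natDegree_leadingCoeff f]
    exact N.add_mem (ih _ (hcard ▸ eraseLead_support_card_lt hf₀) herase rfl) (h f hf)

end LeadingCoefficients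

section VanishingIdeal

variable {R : Type*} [CommRing R]

/-- The integer polynomials vanishing on a subset `S` of a commutative ring. The full annihilator
ideal is the case `S = W(F)`; it is the intersection of the ideals for `I(F)` and `1 + I(F)`. -/
noncomputable def vanishingIdeal (S : Set R) : Ideal ℤ[X] :=
  ⨅ x ∈ S, RingHom.ker (aeval x : ℤ[X] →ₐ[ℤ] R)

theorem mem_vanishingIdeal {S : Set R} {f : ℤ[X]} :
    f ∈ vanishingIdeal S ↔ ∀ x ∈ S, aeval x f = 0 := by
  simp only [vanishingIdeal, Submodule.mem_iInf, RingHom.mem_ker]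

theorem vanishingIdeal_union (S T : Set R) :
    vanishingIdeal (S ∪ T) = vanishingIdeal S ⊓ vanishingIdeal T :=
  iInf_union

theorem addOrderOf_dvd_factorial_mul_coeff {I : Ideal R} {d : ℕ} {f : ℤ[X]}
    (hd : f.natDegree ≤ d) (hf : f ∈ vanishingIdeal (I : Set R)) {y : R} (hy : y ∈ I ^ d) :
    (addOrderOf y : ℤ) ∣ d.factorial * f.coeff d := by
  have hzero := factorial_mul_coeff_mul_eq_zero (f := f.map (algebraMap ℤ R))
    (natDegree_map_le.trans hd)
    (fun x hx => by rw [eval_map_algebraMap, mem_vanishingIdeal.mp hf x hx]) hy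
  rw [addOrderOf_dvd_iff_zsmul_eq_zero, zsmul_eq_mul, ← hzero, coeff_map]
  simp

end VanishingIdeal

section Valuation

variable {p : ℕ} [Fact p.Prime]

theorem pow_sub_padicValNat_dvd_of_pow_dvd_mul {n r : ℕ} (hn : n ≠ 0) {c : ℤ}
    (h : (p : ℤ) ^ r ∣ n * c) : (p : ℤ) ^ (r - padicValNat p n) ∣ c := by
  obtain rfl | hc := eq_or_ne c 0
  · exact dvd_zero _
  have hn' : (n : ℤ) ≠ 0 := Nat.cast_ne_zero.mpr hn
  rw [padicValInt_dvd_iff, padicValInt.mul hn' hc, padicValInt.of_nat] at h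
  rw [padicValInt_dvd_iff]
  exact Or.inr (Nat.sub_le_iff_le_add'.mpr (h.resolve_left (mul_ne_zero hn' hc)))

theorem exists_mem_addOrderOf_eq_prime_pow {R : Type*} [CommRing R] {I : Ideal R} {n : ℕ}
    (hp : (p : R) ^ (n + 1) = 0) (hI : Ideal.span {(p : R) ^ n} * I ≠ ⊥) :
    ∃ y ∈ I, addOrderOf y = p ^ (n + 1) := by
  obtain ⟨y, hy, hne⟩ : ∃ y ∈ I, (p : R) ^ n * y ≠ 0 := by
    by_contra! h
    exact hI (eq_bot_iff.mpr (Ideal.span_singleton_mul_le_iff.mpr h))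
  refine ⟨y, hy, addOrderOf_eq_prime_pow ?_ ?_⟩
  · simpa [nsmul_eq_mul] using hne
  · simp [nsmul_eq_mul, hp]

end Valuation

section IdealJ

theorem two_pow_mul_pow_mem_idealJ (p : ℤ[X]) (r : ℕ) {i k : ℕ} (hi : i < k) :
    2 ^ (r - padicValNat 2 (2 * i).factorial) * p ^ (2 * i) ∈ idealJ p r k :=
  Ideal.subset_span (Or.inl ⟨i, hi, rfl⟩)

theorem pow_mem_idealJ (p : ℤ[X]) (r k : ℕ) : p ^ (2 * k) ∈ idealJ p r k :=
  Ideal.subset_span (Or.inr rfl)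

theorem idealJ_le {p : ℤ[X]} {r k : ℕ} {I : Ideal ℤ[X]}
    (h : ∀ i < k, 2 ^ (r - padicValNat 2 (2 * i).factorial) * p ^ (2 * i) ∈ I)
    (h' : p ^ (2 * k) ∈ I) : idealJ p r k ≤ I := by
  refine Ideal.span_le.mpr ?_
  rintro _ (⟨i, hi, rfl⟩ | rfl)
  exacts [h i hi, h']

theorem idealJ_le_of_dvd {p q : ℤ[X]} (h : p ∣ q) (r k : ℕ) : idealJ q r k ≤ idealJ p r k :=
  idealJ_le
    (fun _ hi => Ideal.mem_of_dvd _ (mul_dvd_mul_left _ (pow_dvd_pow_of_dvd h _))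
      (two_pow_mul_pow_mem_idealJ p r hi))
    (Ideal.mem_of_dvd _ (pow_dvd_pow_of_dvd h _) (pow_mem_idealJ p r k))

theorem comp_mem_idealJ {p f : ℤ[X]} {r k : ℕ} (hf : f ∈ idealJ p r k) (q : ℤ[X]) :
    f.comp q ∈ idealJ (p.comp q) r k := by
  have hle : idealJ p r k ≤ (idealJ (p.comp q) r k).comap (compRingHom q) :=
    idealJ_le
      (fun i hi => by
        simpa [Ideal.mem_comap] using two_pow_mul_pow_mem_idealJ (p.comp q) r hi)
      (by simpa [Ideal.mem_comap] using pow_mem_idealJ (p.comp q) r k)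
  exact hle hf

theorem isCoprime_idealJ {p q : ℤ[X]} (h : IsCoprime p q) (r k : ℕ) :
    IsCoprime (idealJ p r k) (idealJ q r k) := by
  obtain ⟨a, b, hab⟩ : IsCoprime (p ^ (2 * k)) (q ^ (2 * k)) := h.pow
  exact Ideal.isCoprime_iff_exists.mpr
    ⟨_, Ideal.mul_mem_left _ a (pow_mem_idealJ p r k), _,
      Ideal.mul_mem_left _ b (pow_mem_idealJ q r k), hab⟩

theorem mul_pow_mul_mul_pow_mem {A : Type*} [CommSemiring A] {I : Ideal A} {a b p q : A} {m n : ℕ}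
    (ha : a * (p * q) ^ m ∈ I) (hb : b * (p * q) ^ n ∈ I) : a * p ^ m * (b * q ^ n) ∈ I := by
  obtain hmn | hnm := le_total m n
  · refine Ideal.mem_of_dvd _ ⟨b * q ^ (n - m), ?_⟩ ha
    rw [← Nat.sub_add_cancel hmn, Nat.add_sub_cancel, pow_add]
    ring
  · refine Ideal.mem_of_dvd _ ⟨a * p ^ (m - n), ?_⟩ hb
    rw [← Nat.sub_add_cancel hnm, Nat.add_sub_cancel, pow_add]
    ring

theorem idealJ_mul_idealJ_le (p q : ℤ[X]) (r k : ℕ) :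
    idealJ p r k * idealJ q r k ≤ idealJ (p * q) r k := by
  have htop : 1 * (p * q) ^ (2 * k) ∈ idealJ (p * q) r k := by
    rw [one_mul]
    exact pow_mem_idealJ _ r k
  refine (Ideal.span_mul_span' _ _).trans_le (Ideal.span_le.mpr ?_)
  rintro _ ⟨_, ⟨i, hi, rfl⟩ | rfl, _, ⟨j, hj, rfl⟩ | rfl, rfl⟩
  · exact mul_pow_mul_mul_pow_mem (two_pow_mul_pow_mem_idealJ _ r hi)
      (two_pow_mul_pow_mem_idealJ _ r hj)
  · simpa using mul_pow_mul_mul_pow_mem (two_pow_mul_pow_mem_idealJ _ r hi) htop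
  · simpa using mul_pow_mul_mul_pow_mem htop (two_pow_mul_pow_mem_idealJ _ r hj)
  · simpa using mul_pow_mul_mul_pow_mem htop htop

theorem idealJ_mul {p q : ℤ[X]} (h : IsCoprime p q) (r k : ℕ) :
    idealJ (p * q) r k = idealJ p r k * idealJ q r k := by
  refine le_antisymm ?_ (idealJ_mul_idealJ_le p q r k)
  rw [Ideal.mul_eq_inf_of_isCoprime (isCoprime_idealJ h r k)]
  exact le_inf (idealJ_le_of_dvd (dvd_mul_right p q) r k) (idealJ_le_of_dvd (dvd_mul_left q p) r k)

theorem isCoprime_X_X_sub_one {A : Type*} [CommRing A] : IsCoprime (X : A[X]) (X - 1) :=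
  ⟨1, -1, by ring⟩

theorem idealJFull_eq_mul (r k : ℕ) : idealJFull r k = idealJEven r k * idealJOdd r k :=
  idealJ_mul isCoprime_X_X_sub_one r k

theorem idealJFull_eq_inf (r k : ℕ) : idealJFull r k = idealJEven r k ⊓ idealJOdd r k := by
  rw [idealJFull_eq_mul]
  exact Ideal.mul_eq_inf_of_isCoprime (isCoprime_idealJ isCoprime_X_X_sub_one r k)

theorem monomial_mem_idealJEven {r k d : ℕ} {c : ℤ}
    (h : d < 2 * k → (2 : ℤ) ^ r ∣ d.factorial * c) : monomial d c ∈ idealJEven r k := by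
  rw [← C_mul_X_pow_eq_monomial]
  obtain hkd | hdk := le_or_gt (2 * k) d
  · exact Ideal.mem_of_dvd _ (dvd_mul_of_dvd_right (pow_dvd_pow X hkd) _) (pow_mem_idealJ X r k)
  have hval : padicValNat 2 d.factorial = padicValNat 2 (2 * (d / 2)).factorial := by
    conv_lhs => rw [← Nat.div_add_mod d 2]
    exact padicValNat_factorial_mul_add _ (Nat.mod_lt d two_pos)
  have hdvd : (2 : ℤ) ^ (r - padicValNat 2 (2 * (d / 2)).factorial) ∣ c :=
    hval ▸ pow_sub_padicValNat_dvd_of_pow_dvd_mul (p := 2) d.factorial_ne_zero (h hdk)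
  refine Ideal.mem_of_dvd _ (mul_dvd_mul ?_ (pow_dvd_pow X (Nat.mul_div_le d 2)))
    (two_pow_mul_pow_mem_idealJ X r (by omega : d / 2 < k))
  simpa using map_dvd C hdvd

end IdealJ

section DividedPowers

variable {R : Type*} [CommRing R]

/-- Divisibility of every power `x ^ n` by the `p`-part of `n!`. This is the `p`-local form of the
existence of divided powers `x ^ n / n!`, but no choice of quotients is made. -/
def HasDividedPowers (p : ℕ) (x : R) : Prop :=
  ∀ n : ℕ, (p : R) ^ padicValNat p n.factorial ∣ x ^ n

namespace HasDividedPowers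

theorem zero {p : ℕ} : HasDividedPowers p (0 : R) := by
  rintro (_ | n) <;> simp

variable {p : ℕ} [Fact p.Prime]

theorem of_sq_eq {x c : R} (h : x ^ 2 = p * c * x) : HasDividedPowers p x := by
  have hpow : ∀ n : ℕ, x ^ (n + 1) = (p : R) ^ n * (c ^ n * x) := by
    intro n
    induction n with
    | zero => simp
    | succ n ih =>
      rw [pow_succ, ih]
      linear_combination (p : R) ^ n * c ^ n * h
  rintro (_ | n)
  · simp
  · have hlt := padicValNat_factorial_lt_of_ne_zero p n.succ_ne_zero
    exact (pow_dvd_pow _ (Nat.le_of_lt_succ hlt)).trans ⟨_, hpow n⟩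

theorem add {x y : R} (hx : HasDividedPowers p x) (hy : HasDividedPowers p y) :
    HasDividedPowers p (x + y) := by
  intro n
  rw [add_pow]
  refine Finset.dvd_sum fun m hm => ?_
  have hmn : m ≤ n := Finset.mem_range_succ_iff.mp hm
  have hval : padicValNat p n.factorial = padicValNat p m.factorial +
      padicValNat p (n - m).factorial + padicValNat p (n.choose m) := by
    rw [← Nat.choose_mul_factorial_mul_factorial hmn,
      padicValNat.mul (mul_ne_zero (Nat.choose_pos hmn).ne' m.factorial_ne_zero)
        (n - m).factorial_ne_zero,
      padicValNat.mul (Nat.choose_pos hmn).ne' m.factorial_ne_zero]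
    ring
  have hchoose : (p : R) ^ padicValNat p (n.choose m) ∣ n.choose m := by
    exact_mod_cast Nat.cast_dvd_cast (α := R) (pow_padicValNat_dvd (p := p) (n := n.choose m))
  rw [hval, pow_add, pow_add]
  exact mul_dvd_mul (mul_dvd_mul (hx m) (hy (n - m))) hchoose

theorem sum {ι : Type*} {s : Finset ι} {x : ι → R} (hx : ∀ i ∈ s, HasDividedPowers p (x i)) :
    HasDividedPowers p (∑ i ∈ s, x i) :=
  Finset.sum_induction x (HasDividedPowers p) (fun _ _ => add) zero hx

end HasDividedPowers

theorem HasDividedPowers.pow_mul_pow_eq_zero {p : ℕ} {x : R} (hx : HasDividedPowers p x)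
    {r : ℕ} (hp : (p : R) ^ r = 0) (n : ℕ) :
    (p : R) ^ (r - padicValNat p n.factorial) * x ^ n = 0 := by
  obtain ⟨y, hy⟩ := hx n
  rw [hy, ← mul_assoc, ← pow_add, pow_eq_zero_of_le le_tsub_add hp, zero_mul]

end DividedPowers

section AnnihilatorOfIdeal

variable {R : Type*} [CommRing R] {r k : ℕ}

theorem idealJ_le_vanishingIdeal {S : Set R} {p : ℤ[X]}
    (hS : ∀ x ∈ S, HasDividedPowers 2 (aeval x p)) (htwo : (2 : R) ^ r = 0)
    (hk : r ≤ padicValNat 2 (2 * k).factorial) : idealJ p r k ≤ vanishingIdeal S := by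
  have hzero : ∀ x ∈ S, ∀ n : ℕ,
      (2 : R) ^ (r - padicValNat 2 n.factorial) * aeval x p ^ n = 0 := fun x hx n => by
    exact_mod_cast (hS x hx).pow_mul_pow_eq_zero (mod_cast htwo) n
  refine idealJ_le (fun i _ => mem_vanishingIdeal.mpr fun x hx => ?_)
    (mem_vanishingIdeal.mpr fun x hx => ?_)
  · simpa [map_ofNat] using hzero x hx (2 * i)
  · simpa [Nat.sub_eq_zero_of_le hk] using hzero x hx (2 * k)

variable {I : Ideal R} {y : R}

theorem monomial_leadingCoeff_mem_idealJEven (hy : y ∈ I ^ (2 * k - 1))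
    (hord : addOrderOf y = 2 ^ r) {f : ℤ[X]} (hf : f ∈ vanishingIdeal (I : Set R)) :
    monomial f.natDegree f.leadingCoeff ∈ idealJEven r k := by
  refine monomial_mem_idealJEven fun hdeg => ?_
  have hdvd := addOrderOf_dvd_factorial_mul_coeff le_rfl hf
    (Ideal.pow_le_pow_right (Nat.le_sub_one_of_lt hdeg) hy)
  rw [hord] at hdvd
  exact_mod_cast hdvd

variable (hI : ∀ x ∈ I, HasDividedPowers 2 x) (htwo : (2 : R) ^ r = 0)
  (hk : r ≤ padicValNat 2 (2 * k).factorial) (hy : y ∈ I ^ (2 * k - 1))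
  (hord : addOrderOf y = 2 ^ r)
include hI htwo hk hy hord

theorem vanishingIdeal_eq_idealJEven : vanishingIdeal (I : Set R) = idealJEven r k := by
  have hle : idealJEven r k ≤ vanishingIdeal (I : Set R) :=
    idealJ_le_vanishingIdeal (by simpa using hI) htwo hk
  exact le_antisymm
    (le_of_monomial_leadingCoeff_mem hle fun _ => monomial_leadingCoeff_mem_idealJEven hy hord) hle

theorem vanishingIdeal_eq_idealJOdd : vanishingIdeal {x : R | x - 1 ∈ I} = idealJOdd r k := by
  have hle : idealJOdd r k ≤ vanishingIdeal {x : R | x - 1 ∈ I} :=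
    idealJ_le_vanishingIdeal (fun x hx => by simpa using hI _ hx) htwo hk
  refine le_antisymm (fun f hf => ?_) hle
  have hshift : f.comp (X + 1) ∈ vanishingIdeal (I : Set R) := mem_vanishingIdeal.mpr fun x hx => by
    rw [aeval_comp]
    exact mem_vanishingIdeal.mp hf _ (by simpa using hx)
  rw [vanishingIdeal_eq_idealJEven hI htwo hk hy hord] at hshift
  have hback := comp_mem_idealJ hshift (X - 1)
  rwa [comp_assoc, X_comp, add_comp, X_comp, one_comp, sub_add_cancel, comp_X] at hback

theorem vanishingIdeal_univ_eq_idealJFull (hcover : ∀ x : R, x ∈ I ∨ x - 1 ∈ I) :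
    vanishingIdeal (Set.univ : Set R) = idealJFull r k := by
  have huniv : Set.univ = (I : Set R) ∪ {x | x - 1 ∈ I} :=
    (Set.eq_univ_of_forall hcover).symm
  rw [huniv, vanishingIdeal_union, vanishingIdeal_eq_idealJEven hI htwo hk hy hord,
    vanishingIdeal_eq_idealJOdd hI htwo hk hy hord, idealJFull_eq_inf]

end AnnihilatorOfIdeal

section DiagonalForms

variable {F : Type u} [Field F]

/-- Expresses `⟨a⟩ ⊥ ⟨b⟩` in the orthogonal basis `(1, 1)`, `(-b, a)`. -/
noncomputable def prodDiagIsometryEquiv {a b : F} (h : a + b ≠ 0) :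
    (((a + b) • QuadraticMap.sq : QuadraticForm F F).prod
      ((a * b * (a + b)) • QuadraticMap.sq : QuadraticForm F F)).IsometryEquiv
      ((a • QuadraticMap.sq : QuadraticForm F F).prod
        (b • QuadraticMap.sq : QuadraticForm F F)) where
  toFun x := (x.1 - b * x.2, x.1 + a * x.2)
  invFun y := ((a * y.1 + b * y.2) / (a + b), (y.2 - y.1) / (a + b))
  map_add' x y := by ext <;> simp only [Prod.fst_add, Prod.snd_add] <;> ring
  map_smul' c x := by
    ext <;> simp only [Prod.smul_fst, Prod.smul_snd, smul_eq_mul, RingHom.id_apply] <;> ring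
  left_inv x := by ext <;> field_simp <;> ring
  right_inv y := by ext <;> field_simp <;> ring
  map_app' x := by
    simp only [QuadraticMap.prod_apply, smul_apply, QuadraticMap.sq_apply, smul_eq_mul]
    ring

noncomputable def consDiagonalIsometryEquiv {n : ℕ} (w : Fin (n + 1) → Fˣ) :
    (((w 0 : F) • QuadraticMap.sq : QuadraticForm F F).prod
      (QuadraticMap.weightedSumSquares F fun i : Fin n => w i.succ)).IsometryEquiv
      (QuadraticMap.weightedSumSquares F w) where
  toLinearEquiv := Fin.consLinearEquiv F fun _ => F
  map_app' x := by
    simp [QuadraticMap.weightedSumSquares_apply, Fin.sum_univ_succ, Units.smul_def]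

variable [Invertible (2 : F)]

theorem nondegenerate_smul {V : Type u} [AddCommGroup V] [Module F V] {Q : QuadraticForm F V}
    (hQ : Q.Nondegenerate) (a : Fˣ) : QuadraticMap.Nondegenerate (Q := (a : F) • Q) := by
  rw [nondegenerate_iff, injective_iff_map_eq_zero] at *
  intro x hx
  refine hQ x ?_
  simpa using hx

theorem nondegenerate_weightedSumSquares {ι : Type*} [Fintype ι] (w : ι → Fˣ) :
    (QuadraticMap.weightedSumSquares F w).Nondegenerate := by
  rw [QuadraticMap.nondegenerate_iff_radical_eq_bot]
  exact (QuadraticForm.radical_weightedSumSquares (w := fun i => (w i : F))).trans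
    (by simp [Pi.spanSubset])

/-- The one-dimensional form `⟨a⟩`. -/
noncomputable def QuadSpace.diag (a : Fˣ) : QuadSpace F :=
  ⟨F, (a : F) • QuadraticMap.sq, nondegenerate_smul nondegenerate_sq a⟩

/-- The diagonal form `⟨w 0, …, w (n - 1)⟩`. -/
noncomputable def QuadSpace.diagonal {n : ℕ} (w : Fin n → Fˣ) : QuadSpace F :=
  ⟨Fin n → F, QuadraticMap.weightedSumSquares F w, nondegenerate_weightedSumSquares w⟩

theorem tmul_smul_smul {V W : Type u} [AddCommGroup V] [Module F V] [AddCommGroup W] [Module F W]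
    (a b : F) (Q : QuadraticForm F V) (Q' : QuadraticForm F W) :
    QuadraticForm.tmul (a • Q) (b • Q') = (a * b) • QuadraticForm.tmul Q Q' := by
  rw [QuadraticForm.tmul, TensorProduct.smul_tmul_smul]
  exact map_smul (QuadraticForm.tensorDistrib F F) _ _

noncomputable def tmulDiagIsometryEquiv (a b : F) :
    (QuadraticForm.tmul (a • QuadraticMap.sq : QuadraticForm F F)
      (b • QuadraticMap.sq : QuadraticForm F F)).IsometryEquiv
      ((a * b) • QuadraticMap.sq : QuadraticForm F F) where
  toLinearEquiv := TensorProduct.lid F F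
  map_app' x := by
    rw [tmul_smul_smul]
    exact congrArg ((a * b) • ·) (QuadraticForm.tmul_tensorLId_apply QuadraticMap.sq x)

namespace WittRing

theorem mk_congr {X Y : QuadSpace F} (e : X.form.IsometryEquiv Y.form) : mk X = mk Y :=
  congrArg (wittCon F).mk' (IsoClass.sound e)

/-- The Witt class of the one-dimensional form `⟨a⟩`. -/
noncomputable def diag (a : Fˣ) : WittRing F := mk (QuadSpace.diag a)

theorem diag_mul (a b : Fˣ) : diag (a * b) = diag a * diag b :=
  (mk_congr (X := (QuadSpace.diag a).mul (QuadSpace.diag b)) (Y := QuadSpace.diag (a * b))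
    (tmulDiagIsometryEquiv (a : F) b)).symm

theorem diag_neg_one : diag (-1 : Fˣ) = -1 := by
  have e : (((-1 : Fˣ) : F) • QuadraticMap.sq : QuadraticForm F F).IsometryEquiv
      (-QuadraticMap.sq) :=
    ⟨LinearEquiv.refl F F, fun x => by simp⟩
  have hneg : diag (-1 : Fˣ) = mk (QuadSpace.one F).neg :=
    mk_congr (X := QuadSpace.diag (-1)) (Y := (QuadSpace.one F).neg) e
  rw [hneg]
  exact eq_neg_of_add_eq_zero_right (mk_add_mk_neg (.one F))

theorem diag_sq (a : Fˣ) : diag (a ^ 2) = 1 := by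
  have e : (((a ^ 2 : Fˣ) : F) • QuadraticMap.sq : QuadraticForm F F).IsometryEquiv
      QuadraticMap.sq :=
    ⟨LinearEquiv.smulOfUnit a, fun x => by
      change (a * x) * (a * x) = ((a ^ 2 : Fˣ) : F) * (x * x)
      push_cast
      ring⟩
  exact mk_congr (X := QuadSpace.diag (a ^ 2)) (Y := QuadSpace.one F) e

theorem sq_diag (a : Fˣ) : diag a ^ 2 = 1 := by
  rw [sq, ← diag_mul, ← sq, diag_sq]

theorem diag_add_diag {a b c : Fˣ} (h : (a : F) + b = c) :
    diag a + diag b = diag c * (1 + diag a * diag b) := by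
  have e := prodDiagIsometryEquiv (h ▸ c.ne_zero : (a : F) + b ≠ 0)
  rw [h] at e
  calc diag a + diag b = diag c + diag (a * b * c) :=
        (mk_congr (X := (QuadSpace.diag c).add (QuadSpace.diag (a * b * c)))
          (Y := (QuadSpace.diag a).add (QuadSpace.diag b)) e).symm
    _ = diag c * (1 + diag a * diag b) := by
        rw [diag_mul, diag_mul]
        ring

theorem mk_diagonal {n : ℕ} (w : Fin n → Fˣ) : mk (QuadSpace.diagonal w) = ∑ i, diag (w i) := by
  induction n with
  | zero =>
    rw [Fin.sum_univ_zero, ← mk_zero]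
    have e : (QuadraticMap.weightedSumSquares F w).IsometryEquiv
        (0 : QuadraticForm F PUnit.{u + 1}) :=
      ⟨LinearEquiv.ofSubsingleton _ _, fun x => by simp⟩
    exact mk_congr (X := QuadSpace.diagonal w) (Y := QuadSpace.zero F) e
  | succ n ih =>
    rw [Fin.sum_univ_succ, ← ih]
    exact (mk_congr (X := (QuadSpace.diag (w 0)).add (QuadSpace.diagonal fun i => w i.succ))
      (Y := QuadSpace.diagonal w) (consDiagonalIsometryEquiv w)).symm

theorem exists_mk_eq_sum_diag (X : QuadSpace F) :
    ∃ w : Fin (Module.finrank F X.V) → Fˣ, mk X = ∑ i, diag (w i) := by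
  obtain ⟨w, ⟨e⟩⟩ := X.form.equivalent_weightedSumSquares_units_of_nondegenerate'
    (QuadraticMap.nondegenerate_associated_iff.mpr X.nondegenerate).1
  exact ⟨w, (mk_congr (Y := QuadSpace.diagonal w) e).trans (mk_diagonal w)⟩

end WittRing

end DiagonalForms

section WittRingTorsion

variable {F : Type u} [Field F] [Invertible (2 : F)]

namespace WittRing

/-- Pfister's argument: splitting `c` into two sums `a`, `b` of half as many squares, the induction
hypothesis makes `⟨a⟩`, `⟨b⟩` and `⟨ab⟩` all act as `1` on `2 ^ n`. -/
theorem two_pow_mul_diag_of_sum_sq_eq {ι : Type*} {n : ℕ} {s : Finset ι} {v : ι → F} {c : Fˣ}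
    (hs : s.card = 2 ^ n) (hc : ∑ i ∈ s, v i ^ 2 = c) : (2 : WittRing F) ^ n * diag c = 2 ^ n := by
  induction n generalizing s c with
  | zero =>
    obtain ⟨i, rfl⟩ := Finset.card_eq_one.mp hs
    rw [Finset.sum_singleton] at hc
    have hi : v i ≠ 0 := (pow_ne_zero_iff two_ne_zero).mp (hc ▸ c.ne_zero)
    have hc' : c = Units.mk0 (v i) hi ^ 2 := Units.ext (by simp [hc])
    rw [hc', diag_sq, mul_one]
  | succ n ih =>
    classical
    obtain ⟨t, hts, ht⟩ := Finset.exists_subset_card_eq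
      (hs ▸ Nat.pow_le_pow_right two_pos n.le_succ : 2 ^ n ≤ s.card)
    have ht' : (s \ t).card = 2 ^ n := by
      rw [Finset.card_sdiff_of_subset hts, hs, ht, pow_succ]
      omega
    rw [← Finset.sum_sdiff hts] at hc
    rw [pow_succ, mul_right_comm]
    by_cases ha₀ : ∑ i ∈ s \ t, v i ^ 2 = 0
    · rw [ih ht (by rwa [ha₀, zero_add] at hc)]
    by_cases hb₀ : ∑ i ∈ t, v i ^ 2 = 0
    · rw [ih ht' (by rwa [hb₀, add_zero] at hc)]
    obtain ⟨a, ha⟩ := isUnit_iff_ne_zero.mpr ha₀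
    obtain ⟨b, hb⟩ := isUnit_iff_ne_zero.mpr hb₀
    have hda := ih ht' ha.symm
    have hdb := ih ht hb.symm
    have hadd : diag a + diag b = diag c * (1 + diag a * diag b) :=
      diag_add_diag (by rw [ha, hb, hc])
    linear_combination (-(2 : WittRing F) ^ n) * hadd + hda + hdb - diag c * (diag b * hda + hdb)

theorem two_pow_eq_zero_of_level_eq {n : ℕ} (h : level F = 2 ^ n) :
    (2 : WittRing F) ^ (n + 1) = 0 := by
  obtain ⟨v, hv⟩ : ∃ v : Fin (level F) → F, ∑ i, v i ^ 2 = -1 :=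
    Nat.sInf_mem (Nat.nonempty_of_pos_sInf (h ▸ Nat.two_pow_pos n : 0 < level F))
  have hneg : (2 : WittRing F) ^ n * diag (-1) = 2 ^ n :=
    two_pow_mul_diag_of_sum_sq_eq (s := Finset.univ) (v := v) (by simpa using h) (by simpa using hv)
  rw [diag_neg_one] at hneg
  linear_combination -hneg

theorem hasDividedPowers_of_mem_fundamentalIdeal {φ : WittRing F} (h : φ ∈ fundamentalIdeal F) :
    HasDividedPowers 2 φ := by
  obtain ⟨X, ⟨m, hm⟩, rfl⟩ := h
  obtain ⟨w, hw⟩ := exists_mk_eq_sum_diag X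
  have hsum : mk X = ∑ i, (diag (w i) - 1) + 2 * m := by
    have hrank : ((Module.finrank F X.V : ℕ) : WittRing F) = m + m := mod_cast congrArg Nat.cast hm
    rw [hw, Finset.sum_sub_distrib, Finset.sum_const, Finset.card_fin, nsmul_one]
    linear_combination hrank
  rw [hsum]
  refine .add (.sum fun i _ => .of_sq_eq (c := -1) ?_) (.of_sq_eq (c := m) ?_)
  · push_cast
    linear_combination sq_diag (w i)
  · push_cast
    ring

theorem mem_or_sub_one_mem_fundamentalIdeal (φ : WittRing F) :
    φ ∈ fundamentalIdeal F ∨ φ - 1 ∈ fundamentalIdeal F := by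
  obtain ⟨X, rfl⟩ := φ.exists_mk
  obtain heven | hodd := Nat.even_or_odd (Module.finrank F X.V)
  · exact Or.inl ⟨X, heven, rfl⟩
  · have hrank : Module.finrank F (X.V × F) = Module.finrank F X.V + 1 := by
      rw [Module.finrank_prod, Module.finrank_self]
    refine Or.inr ⟨X.add (QuadSpace.diag (-1)), hrank ▸ hodd.add_one, ?_⟩
    rw [sub_eq_add_neg, ← diag_neg_one]
    rfl

end WittRing

theorem annihilatorIdeal_eq_vanishingIdeal_univ :
    annihilatorIdeal F = vanishingIdeal (Set.univ : Set (WittRing F)) :=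
  Ideal.ext fun _ => by simp [mem_vanishingIdeal, annihilatorIdeal]

end WittRingTorsion

end QuadWitt

theorem mainTheorem2 {F : Type*} [Field F] [Invertible (2 : F)]
    (hF : IsSumSq (-1 : F)) (r k : ℕ)
    (hs : QuadWitt.level F = 2 ^ (r - 1))
    (hk₁ : padicValNat 2 (2 * k - 2).factorial < r)
    (hk₂ : r ≤ padicValNat 2 (2 * k).factorial)
    (hI : Ideal.span {(QuadWitt.level F : QuadWitt.WittRing F)} *
      QuadWitt.fundamentalIdeal F ^ (2 * k - 1) ≠ ⊥) :
    QuadWitt.annihilatorIdeal F = QuadWitt.idealJFull r k ∧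
      QuadWitt.idealJFull r k = QuadWitt.idealJEven r k * QuadWitt.idealJOdd r k := by
  refine ⟨?_, QuadWitt.idealJFull_eq_mul r k⟩
  obtain ⟨n, rfl⟩ := Nat.exists_eq_add_one_of_ne_zero (Nat.ne_zero_of_lt hk₁)
  rw [Nat.add_sub_cancel] at hs
  have htwo : (2 : QuadWitt.WittRing F) ^ (n + 1) = 0 :=
    QuadWitt.WittRing.two_pow_eq_zero_of_level_eq hs
  rw [hs] at hI
  obtain ⟨y, hy, hord⟩ :=
    QuadWitt.exists_mem_addOrderOf_eq_prime_pow (p := 2) (mod_cast htwo) (by exact_mod_cast hI)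
  rw [QuadWitt.annihilatorIdeal_eq_vanishingIdeal_univ]
  exact QuadWitt.vanishingIdeal_univ_eq_idealJFull
    (fun _ => QuadWitt.WittRing.hasDividedPowers_of_mem_fundamentalIdeal) htwo hk₂ hy hord
    QuadWitt.WittRing.mem_or_sub_one_mem_fundamentalIdeal
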